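/- Let $A$ be an Artin algebra (a ring that is a finitely generated module over a commutative artinian ring acting centrally) which is selfinjective, i.e. injective as a left module over itself, and let $n\ge 2$. Let $A\text{-mod}$ be the category of finitely generated left $A$-modules and $A\text{-}\underline{\mathrm{mod}}$ its quotient by the maps factoring through a projective module. For a category $\mathcal C$, objects of $\mathrm{Mor}_n(\mathcal C)$ are chains $X_n\xrightarrow{\phi_{n-1}}X_{n-1}\to\cdots\to X_2\xrightarrow{\phi_1}X_1$ in $\mathcal C$ and morphisms are commutative ladders; write $\mathrm{Mor}_n(A)=\mathrm{Mor}_n(A\text{-mod})$, and $\underline X\in\mathrm{Mor}_n(A\text{-}\underline{\mathrm{mod}})$ for the image of $X\in \mathrm{Mor}_n(A)$. Cokernel: $\mathbf{Cok}\,X=(X_1\to\mathrm{Coker}(\phi_1\cdots\phi_{n-1})\to\cdots\to\mathrm{Coker}(\phi_1\phi_2)\to\mathrm{Coker}\,\phi_1)$ with the canonical epimorphisms. Mimo: for $1\le i\le n-1$ choose an injective envelope $\mathrm{Ker}\,\phi_i\hookrightarrow \mathrm{IKer}\,\phi_i$ and an extension $e_i:X_{i+1}\to\mathrm{IKer}\,\phi_i$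 of it. Then $\mathbf{Mimo}\,X$ has $i$-th branch $X_i\oplus\mathrm{IKer}\,\phi_i\oplus\cdots\oplus\mathrm{IKer}\,\phi_{n-1}$ and $i$-th morphism, from branch $i+1$ to branch $i$, $(x,c_{i+1},\dots,c_{n-1})\mapsto(\phi_i x,e_i x,c_{i+1},\dots,c_{n-1})$. Rotation: let $S\in\mathrm{Mor}_n(A\text{-}\underline{\mathrm{mod}})$ have branches $X_n,\dots,X_1$. Choose maps $\phi_i:X_{i+1}\to X_i$ in $A\text{-mod}$ representing the morphisms of $S$ and, for $1\le i\le n-1$, an injective envelope $h_{i+1}:X_{i+1}\to I_{i+1}$ and a pushout of $X_1\xleftarrow{\phi_1\cdots\phi_i}X_{i+1}\xrightarrow{h_{i+1}}I_{i+1}$, with maps $g_{i+1}:X_1\to Y_{i+1}$ and $j_{i+1}:I_{i+1}\to Y_{i+1}$. For $1\le i\le n-2$ choose $s_i:I_{i+2}\to I_{i+1}$ with $s_ih_{i+2}=h_{i+1}\phi_{i+1}$, and let $\psi_i:Y_{i+2}\to Y_{i+1}$ be the map with $\psi_ig_{i+2}=g_{i+1}$ and $\psi_ij_{i+2}=j_{i+1}s_i$.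 The rotation is $\mathbf{Rot}\,S=(X_1\xrightarrow{\underline{g_n}}Y_n\xrightarrow{\underline{\psi_{n-2}}}\cdots\xrightarrow{\underline{\psi_1}}Y_2)\in\mathrm{Mor}_n(A\text{-}\underline{\mathrm{mod}})$. Then the choices in both constructions are always possible, and: (1) for every $X\in\mathrm{Mor}_n(A)$ and for all choices in the two constructions, $\mathbf{Rot}\,\underline X\cong\underline{\mathbf{Cok}\,\mathbf{Mimo}\,X}$ in $\mathrm{Mor}_n(A\text{-}\underline{\mathrm{mod}})$; (2) the rotation is well defined up to isomorphism: if $S\cong T$ in $\mathrm{Mor}_n(A\text{-}\underline{\mathrm{mod}})$, then $\mathbf{Rot}\,S\cong\mathbf{Rot}\,T$ for all choices made in forming the two rotations. -/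

import Mathlib

open CategoryTheory

universe u w

noncomputable section

namespace MorphismCategory

/-! Conventions. `FGModuleCat A` is the category of finitely generated left `A`-modules.
For `n = N + 1`, an object `X_n ⟶ X_{n-1} ⟶ ⋯ ⟶ X_1` of the morphism category `Mor_n(A)` is an
object of `ComposableArrows (FGModuleCat A) N`; the branch `X_i` sits at position `n - i`.  In
particular `X_n` sits at position `0` and `X_1` at position `Fin.last N`. -/

/-- An injective envelope `f : M → E`: `E` is injective, `f` is a monomorphism and its image is
an essential submodule of `E`. -/
structure IsInjectiveEnvelope {A : Type u} [Ring A] {M E : Type u} [AddCommGroup M] [Module A M]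
    [AddCommGroup E] [Module A E] (f : M →ₗ[A] E) : Prop where
  injective_module : Module.Injective A E
  injective : Function.Injective f
  essential : ∀ N : Submodule A E, Disjoint N (LinearMap.range f) → N = ⊥

section StableCategory

variable (A : Type u) [Ring A]

/-- Two maps of finitely generated modules are related when their difference factors through a
finitely generated projective module. -/
def stableRel : HomRel (FGModuleCat.{u} A) := fun M N f g =>
  ∃ (P : FGModuleCat.{u} A) (a : M ⟶ P) (b : P ⟶ N), Module.Projective A P ∧ f - g = a ≫ b

instance stableRel_congruence : Congruence (stableRel A) where
  equivalence {M N} :=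
    { refl := fun f => ⟨FGModuleCat.of A PUnit, 0, 0, by infer_instance, by simp⟩
      symm {f g} := by
        rintro ⟨P, a, b, hP, h⟩
        exact ⟨P, -a, b, hP, by rw [Preadditive.neg_comp, ← h, neg_sub]⟩
      trans {f g k} := by
        rintro ⟨P, a, b, hP, h⟩ ⟨Q, c, d, hQ, h'⟩
        refine ⟨FGModuleCat.of A (P × Q),
          FGModuleCat.ofHom (a.hom.hom.prod c.hom.hom),
          FGModuleCat.ofHom (b.hom.hom.coprod d.hom.hom),
          inferInstanceAs (Module.Projective A (P × Q)), ?_⟩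
        have e : f - k = a ≫ b + c ≫ d := by rw [← h, ← h']; abel
        rw [e]
        rfl }
  comp_left f g g' := by
    rintro ⟨P, a, b, hP, h⟩
    exact ⟨P, f ≫ a, b, hP, by rw [← Preadditive.comp_sub, h, Category.assoc]⟩
  comp_right g := by
    rintro ⟨P, a, b, hP, h⟩
    exact ⟨P, a, b ≫ g, hP, by rw [← Preadditive.sub_comp, h, Category.assoc]⟩

/-- The stable category of finitely generated `A`-modules modulo projectives. -/
abbrev StMod := CategoryTheory.Quotient (stableRel A)

/-- The functor `Mor_{N+1}(A) ⥤ Mor_{N+1}(StMod A)` sending `X` to its stable image. -/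
abbrev stabilize (N : ℕ) :
    ComposableArrows (FGModuleCat.{u} A) N ⥤ ComposableArrows (StMod A) N :=
  (CategoryTheory.Quotient.functor (stableRel A)).mapComposableArrows N

end StableCategory

variable {A : Type u} [Ring A]

/-- The morphism of `X` from position `k` to position `k + 1`. -/
abbrev step {N : ℕ} (X : ComposableArrows (FGModuleCat.{u} A) N) (k : Fin N) :
    X.obj k.castSucc ⟶ X.obj k.succ :=
  X.map (homOfLE (Fin.castSucc_lt_succ).le)

/-- The composite of the morphisms of `X` from position `k` to the last one, `X_1`. -/
abbrev toLast {N : ℕ} (X : ComposableArrows (FGModuleCat.{u} A) N) (k : Fin (N + 1)) :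
    X.obj k ⟶ X.obj (Fin.last N) :=
  X.map (homOfLE (Fin.le_last k))

section Cokernel

variable {m : ℕ} (X : ComposableArrows (FGModuleCat.{u} A) (m + 1))

/-- The chain `Coker (φ_1 ⋯ φ_{n-1}) ⟶ ⋯ ⟶ Coker (φ_1 φ_2) ⟶ Coker φ_1` of canonical
epimorphisms, where `n = m + 2`. -/
def cokChain : ComposableArrows (FGModuleCat.{u} A) m where
  obj k := FGModuleCat.of A
    (X.obj (Fin.last (m + 1)) ⧸ LinearMap.range (toLast X k.castSucc).hom.hom)
  map {k l} f := FGModuleCat.ofHom (Submodule.factor (by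
    have hkl : k.castSucc ≤ l.castSucc := Fin.castSucc_le_castSucc_iff.mpr (leOfHom f)
    have e : toLast X k.castSucc = X.map (homOfLE hkl) ≫ toLast X l.castSucc := by
      rw [← X.map_comp]; rfl
    rw [e, FGModuleCat.hom_hom_comp]
    exact LinearMap.range_comp_le_range _ _))
  map_id k := by
    ext x
    rfl
  map_comp f g := by
    ext x
    rfl

/-- The object `Cok X`, namely
`X_1 ⟶ Coker (φ_1 ⋯ φ_{n-1}) ⟶ ⋯ ⟶ Coker (φ_1 φ_2) ⟶ Coker φ_1`. -/
def cok : ComposableArrows (FGModuleCat.{u} A) (m + 1) :=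
  (cokChain X).precomp (X := X.obj (Fin.last (m + 1)))
    (FGModuleCat.ofHom (Submodule.mkQ (LinearMap.range (toLast X 0).hom.hom)))

end Cokernel

section Mimo

/-- The choices in the construction of `Mimo X`: for each morphism `φ` of `X`, an injective
envelope `Ker φ → IKer φ` and an extension `e` of it to the source of `φ`. -/
structure MimoData {N : ℕ} (X : ComposableArrows (FGModuleCat.{u} A) N) where
  IKer : Fin N → FGModuleCat.{u} A
  e : ∀ k : Fin N, X.obj k.castSucc ⟶ IKer k
  envelope : ∀ k : Fin N, IsInjectiveEnvelope
    ((e k).hom.hom ∘ₗ (LinearMap.ker (step X k).hom.hom).subtype)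

namespace MimoData

variable {N : ℕ} {X : ComposableArrows (FGModuleCat.{u} A) N} (M : MimoData X)

/-- The branch `X_i ⊕ IKer φ_i ⊕ ⋯ ⊕ IKer φ_{n-1}` at position `k = n - i`. -/
abbrev branch (k : Fin (N + 1)) : FGModuleCat.{u} A :=
  FGModuleCat.of A
    (X.obj k × (∀ j : Fin k.val, M.IKer (Fin.castLE (Nat.le_of_lt_succ k.isLt) j)))

/-- The linear map `θ`, sending `(x, c)` to `(φ x, (c, e x))`; the new last component `e x`
belongs to the summand `IKer` of the morphism `φ` at position `k`. -/
def thetaLin (k : Fin N) :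
    (X.obj k.castSucc × (∀ j : Fin k.val, M.IKer (Fin.castLE k.isLt.le j))) →ₗ[A]
      (X.obj k.succ × (∀ j : Fin (k.val + 1), M.IKer (Fin.castLE k.isLt j))) :=
  LinearMap.prod ((step X k).hom.hom ∘ₗ LinearMap.fst A _ _)
    (LinearMap.pi (Fin.lastCases
      ((M.e k).hom.hom ∘ₗ LinearMap.fst A _ _)
      (fun j => LinearMap.proj (φ := fun j : Fin k.val =>
        (M.IKer (Fin.castLE k.isLt.le j) : Type u)) j ∘ₗ LinearMap.snd A _ _)))

/-- The map `θ` as a morphism between consecutive branches. -/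
def theta (k : Fin N) : M.branch k.castSucc ⟶ M.branch k.succ :=
  FGModuleCat.ofHom (M.thetaLin k)

/-- The object `Mimo X`. -/
def mimo : ComposableArrows (FGModuleCat.{u} A) N :=
  ComposableArrows.mkOfObjOfMapSucc M.branch M.theta

end MimoData

end Mimo

section Rotation

/-- The choices in the construction of the rotation of an object `S` of `Mor_n(StMod A)`, with
`n = m + 2`. -/
structure RotationData {m : ℕ} (S : ComposableArrows (StMod A) (m + 1)) where
  /-- representatives of the morphisms of `S` -/
  rep : ComposableArrows (FGModuleCat.{u} A) (m + 1)
  rep_eq : (stabilize A (m + 1)).obj rep = S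
  /-- injective envelopes `h` of `X_n, …, X_2` -/
  I : Fin (m + 1) → FGModuleCat.{u} A
  h : ∀ k : Fin (m + 1), rep.obj k.castSucc ⟶ I k
  envelope : ∀ k, IsInjectiveEnvelope (h k).hom.hom
  /-- pushouts `Y` of the composites to `X_1` along the injective envelopes -/
  Y : Fin (m + 1) → FGModuleCat.{u} A
  g : ∀ k : Fin (m + 1), rep.obj (Fin.last (m + 1)) ⟶ Y k
  j : ∀ k : Fin (m + 1), I k ⟶ Y k
  isPushout : ∀ k, IsPushout (toLast rep k.castSucc) (h k) (g k) (j k)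
  /-- extensions of the morphisms of `X` to the injective envelopes -/
  s : ∀ k : Fin m, I k.castSucc ⟶ I k.succ
  comm : ∀ k : Fin m, h k.castSucc ≫ s k = step rep k.castSucc ≫ h k.succ

namespace RotationData

variable {m : ℕ} {S : ComposableArrows (StMod A) (m + 1)} (D : RotationData S)

/-- The map between consecutive pushouts induced by the identity of `X_1` and by the chosen
extension. -/
def psi (k : Fin m) : D.Y k.castSucc ⟶ D.Y k.succ :=
  (D.isPushout k.castSucc).desc (D.g k.succ) (D.s k ≫ D.j k.succ) (by
    have e : toLast D.rep k.castSucc.castSucc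
        = step D.rep k.castSucc ≫ toLast D.rep k.succ.castSucc := by
      exact D.rep.map_comp (homOfLE (Fin.castSucc_lt_succ (i := k.castSucc)).le)
        (homOfLE (Fin.le_last (k.castSucc.succ)))
    rw [e, Category.assoc, (D.isPushout k.succ).w, ← Category.assoc, ← D.comm k,
      Category.assoc])

/-- The rotation `X_1 ⟶ Y_n ⟶ ⋯ ⟶ Y_2`, as an object of `Mor_n(StMod A)`. -/
def rot : ComposableArrows (StMod A) (m + 1) :=
  (stabilize A (m + 1)).obj
    ((ComposableArrows.mkOfObjOfMapSucc D.Y D.psi).precomp (D.g 0))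

end RotationData

end Rotation

end MorphismCategory

end

/-! Over a selfinjective Artin algebra finitely generated projectives and injectives coincide, so
both vanish stably. The projection `Mimo X ⟶ X` is branchwise split with injective kernel, hence a
stable isomorphism, and `Mimo X` is a chain of monomorphisms. For such a chain each pushout `Y` maps
onto the corresponding cokernel with kernel the injective `I`, so the rotation is stably the
cokernel chain (`nonempty_rot_iso_cok`). Statement (1) therefore follows from (2).

For (2), a stable isomorphism between two chains need not come from a ladder of modules, but it does
when the source consists of monomorphisms: a defect factoring through a projective extends along a
monomorphism, because the projective is injective, and can be subtracted (`exists_lift_square`).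
Hence `Mimo` of one representative maps to both representatives by honest ladders of stable
isomorphisms. Such a ladder induces stable isomorphisms of pushouts by a stable five lemma
(`isStableIso_of_exact`), and the resulting squares commute up to maps through injectives
(`nonempty_rot_iso_of_rep`).

That injectives are projective rests on embedding finitely generated modules into free ones. This
reduces to finding every simple module inside `A`, which is a pigeonhole argument on the finitely
many annihilators of simple modules. -/

namespace MorphismCategory

/-! ### Simple modules and embeddings into free modules -/

section SelfInjective

variable {A : Type u} [Ring A]

/-- Finitely many of the maps `M → N` separate the points of an artinian module `M` as soon as
all of them do. -/
theorem exists_injective_pi {M N : Type*} [AddCommGroup M] [Module A M] [AddCommGroup N]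
    [Module A N] [IsArtinian A M] (h : ∀ x : M, x ≠ 0 → ∃ f : M →ₗ[A] N, f x ≠ 0) :
    ∃ (n : ℕ) (f : M →ₗ[A] (Fin n → N)), Function.Injective f := by
  obtain ⟨_, ⟨n, f, rfl⟩, hmin⟩ := IsArtinian.set_has_minimal (R := A) (M := M)
    {K | ∃ (n : ℕ) (f : M →ₗ[A] (Fin n → N)), K = LinearMap.ker f} ⟨_, 0, 0, rfl⟩
  refine ⟨n, f, (injective_iff_map_eq_zero f).mpr fun x hx => ?_⟩
  by_contra hx0
  obtain ⟨g, hg⟩ := h x hx0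
  -- Adjoining `g` to the tuple would strictly shrink the minimal kernel, since `x` leaves it.
  refine hmin _ ⟨n + 1, LinearMap.pi (Fin.cons g fun i => LinearMap.proj i ∘ₗ f), rfl⟩ ?_
  refine lt_of_le_of_ne (fun y hy => ?_) fun he => hg ?_
  · funext i
    simpa using congrFun (LinearMap.mem_ker.mp hy) i.succ
  · have hx' : x ∈ LinearMap.ker f := hx
    rw [← he] at hx'
    simpa using congrFun (LinearMap.mem_ker.mp hx') 0

/-- Over a left artinian ring a simple module is determined by its annihilator. -/
theorem nonempty_linearEquiv_of_annihilator_le [IsArtinianRing A] {S T : Type u}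
    [AddCommGroup S] [Module A S] [AddCommGroup T] [Module A T] [IsSimpleModule A S]
    [IsSimpleModule A T] (h : Module.annihilator A S ≤ Module.annihilator A T) :
    Nonempty (S ≃ₗ[A] T) := by
  have hsep : ∀ x : A ⧸ Module.annihilator A S, x ≠ 0 →
      ∃ f : (A ⧸ Module.annihilator A S) →ₗ[A] S, f x ≠ 0 := by
    intro x hx
    obtain ⟨a, rfl⟩ := Submodule.mkQ_surjective _ x
    have ha : a ∉ Module.annihilator A S := fun ha => hx ((Submodule.Quotient.mk_eq_zero _).mpr ha)
    rw [Module.mem_annihilator] at ha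
    push Not at ha
    obtain ⟨s, hs⟩ := ha
    exact ⟨Submodule.liftQ _ (LinearMap.toSpanSingleton A S s) fun b hb => by
      simpa using Module.mem_annihilator.mp hb s,
      fun h0 => hs ((Submodule.liftQ_apply _ _ a).symm.trans h0)⟩
  obtain ⟨n, f, hf⟩ := exists_injective_pi hsep
  have : IsSemisimpleModule A (A ⧸ Module.annihilator A S) := IsSemisimpleModule.of_injective f hf
  have := IsSimpleModule.nontrivial A T
  obtain ⟨t, ht⟩ := exists_ne (0 : T)
  let q : (A ⧸ Module.annihilator A S) →ₗ[A] T :=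
    Submodule.liftQ _ (LinearMap.toSpanSingleton A T t) fun b hb => by
      simpa using Module.mem_annihilator.mp (h hb) t
  have hq : Function.Surjective q := fun y => by
    obtain ⟨a, ha⟩ := IsSimpleModule.toSpanSingleton_surjective A ht y
    exact ⟨Submodule.mkQ _ a, (Submodule.liftQ_apply _ _ a).trans ha⟩
  -- `A / ann S` embeds in a power of `S`, so it is semisimple and its quotient `T` splits off. Some
  -- coordinate `T → S` is then nonzero, and Schur's lemma applies.
  obtain ⟨r, hr⟩ := IsSemisimpleModule.lifting_property q hq LinearMap.id
  have hrt : f (r t) ≠ 0 := fun h0 => ht <| by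
    have := hf (h0.trans (map_zero f).symm)
    simpa [this] using (LinearMap.congr_fun hr t).symm
  obtain ⟨i, hi⟩ : ∃ i, f (r t) i ≠ 0 := by
    by_contra! hc
    exact hrt (funext hc)
  rcases LinearMap.bijective_or_eq_zero (LinearMap.proj i ∘ₗ f ∘ₗ r : T →ₗ[A] S) with hb | h0
  · exact ⟨(LinearEquiv.ofBijective _ hb).symm⟩
  · exact absurd (LinearMap.congr_fun h0 t) hi

/-- The defining property of the prime ideals of a noncommutative ring, for arbitrary subsets. -/
def IsPrimeSet (Q : Set A) : Prop :=
  (1 : A) ∉ Q ∧ ∀ a b, (∀ c, a * c * b ∈ Q) → a ∈ Q ∨ b ∈ Q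

/-- If `a` moves `x` and `b` moves `y`, simplicity gives `x = c • b • y`, so `a * c * b` moves `y`.
-/
theorem isPrimeSet_annihilator (S : Type u) [AddCommGroup S] [Module A S] [IsSimpleModule A S] :
    IsPrimeSet (Module.annihilator A S : Set A) := by
  have := IsSimpleModule.nontrivial A S
  obtain ⟨s, hs⟩ := exists_ne (0 : S)
  refine ⟨fun h => hs (by simpa using Module.mem_annihilator.mp h s), fun a b hab => ?_⟩
  by_contra! hc
  obtain ⟨ha, hb⟩ := hc
  simp only [SetLike.mem_coe, Module.mem_annihilator, not_forall] at ha hb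
  obtain ⟨x, hx⟩ := ha
  obtain ⟨y, hy⟩ := hb
  obtain ⟨c, rfl⟩ := IsSimpleModule.toSpanSingleton_surjective A hy x
  exact hx (by simpa [mul_smul] using Module.mem_annihilator.mp (hab c) y)

/-- The ring elements that annihilate from the right all images of `S` in the ring. -/
def dualAnnihilator (A : Type u) [Ring A] (S : Type u) [AddCommGroup S] [Module A S] : Set A :=
  {b | ∀ (f : S →ₗ[A] A) (s : S), f s * b = 0}

theorem dualAnnihilator_congr {S T : Type u} [AddCommGroup S] [Module A S] [AddCommGroup T]
    [Module A T] (e : S ≃ₗ[A] T) : dualAnnihilator A S = dualAnnihilator A T := by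
  ext b
  exact ⟨fun h f t => by simpa using h (f ∘ₗ e.toLinearMap) (e.symm t),
    fun h f s => by simpa using h (f ∘ₗ e.symm.toLinearMap) (e s)⟩

/-- Over a left selfinjective ring the dual of a simple module is zero or simple, so that its
annihilator is prime if it is proper. -/
theorem isPrimeSet_dualAnnihilator (hA : Module.Injective A A) (S : Type u) [AddCommGroup S]
    [Module A S] [IsSimpleModule A S] (h1 : (1 : A) ∉ dualAnnihilator A S) :
    IsPrimeSet (dualAnnihilator A S) := by
  refine ⟨h1, fun a b hab => or_iff_not_imp_left.mpr fun ha g s => ?_⟩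
  simp only [dualAnnihilator, Set.mem_ofPred_eq, not_forall] at ha
  obtain ⟨f, t, hft⟩ := ha
  let k : S →ₗ[A] A := LinearMap.toSpanSingleton A A a ∘ₗ f
  have hk : Function.Injective k := k.injective_or_eq_zero.resolve_right fun h0 =>
    hft (by simpa [k] using LinearMap.congr_fun h0 t)
  -- Extending `g` along the embedding `k = f · a` makes `g` equal to `k` followed by right
  -- multiplication by `l 1`.
  obtain ⟨l, hl⟩ := hA.out k hk g
  have e : g s = f s * a * l 1 := by
    rw [← hl s, ← smul_eq_mul, ← map_smul]
    simp [k]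
  rw [e]
  simpa [mul_assoc] using hab (l 1) f s

/-- Maximality argument producing simple subquotients of a left artinian ring. -/
theorem exists_simple_subquotient [IsArtinianRing A] (p : Ideal A → Prop) (h0 : p ⊥)
    (h1 : ¬ p ⊤) : ∃ L L' : Ideal A, L ≤ L' ∧ p L ∧ ¬ p L' ∧
      IsSimpleModule A (L' ⧸ Submodule.comap L'.subtype L) := by
  obtain ⟨L, hL, hmax⟩ := set_has_maximal_iff_noetherian.mpr
    (inferInstance : IsNoetherianRing A) {L : Ideal A | p L} ⟨⊥, h0⟩
  have hL' : ¬ IsMax L := fun h => h1 (by rwa [isMax_iff_eq_top.mp h] at hL)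
  obtain ⟨L', hc⟩ := exists_covBy_of_wellFoundedLT hL'
  exact ⟨L, L', hc.le, hL, fun h => hmax L' h hc.lt, (covBy_iff_quot_is_simple hc.le).mp hc⟩

/-- Take `L` maximal among left ideals killed from the right by some `a ∉ Q`, and `S = L'/L` with
`L'` covering `L`. Right multiplication by `a * c` is a map `S → A`, so if `b ∉ Q` kills all such
images, primeness gives `a * c * b ∉ Q` killing `L'`, against maximality. -/
theorem exists_dualAnnihilator_subset [IsArtinianRing A] {Q : Set A} (hQ : IsPrimeSet Q)
    (hQ0 : (0 : A) ∈ Q) :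
    ∃ (S : Type u) (_ : AddCommGroup S) (_ : Module A S), IsSimpleModule A S ∧
      dualAnnihilator A S ⊆ Q := by
  obtain ⟨L, L', hle, ⟨a, haQ, ha⟩, hL', hS⟩ := exists_simple_subquotient
    (fun L : Ideal A => ∃ a ∉ Q, ∀ x ∈ L, x * a = 0) ⟨1, hQ.1, by simp⟩
    fun ⟨a, ha, h⟩ => ha (by simpa [← show a = 0 by simpa using h 1 trivial] using hQ0)
  refine ⟨_, _, _, hS, fun b hb => ?_⟩
  by_contra hbQ
  have : ¬ ∀ c, a * c * b ∈ Q := fun h => (hQ.2 a b h).elim haQ hbQ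
  push Not at this
  obtain ⟨c, hc⟩ := this
  refine hL' ⟨_, hc, fun x hx => ?_⟩
  let f : (L' ⧸ Submodule.comap L'.subtype L) →ₗ[A] A :=
    Submodule.liftQ _ (LinearMap.toSpanSingleton A A (a * c) ∘ₗ L'.subtype) fun y hy => by
      simp [← mul_assoc, ha y hy]
  simpa [f, mul_assoc] using hb f (Submodule.mkQ _ ⟨x, hx⟩)

/-- The mirror argument, with `a` killing `L` from the left: if `b` annihilates `L'/L` then `c * b`
sends `L'` into `L`, so `a * c * b` kills `L'`. -/
theorem exists_annihilator_subset [IsArtinianRing A] {Q : Set A} (hQ : IsPrimeSet Q)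
    (hQ0 : (0 : A) ∈ Q) :
    ∃ (S : Type u) (_ : AddCommGroup S) (_ : Module A S), IsSimpleModule A S ∧
      (Module.annihilator A S : Set A) ⊆ Q := by
  obtain ⟨L, L', hle, ⟨a, haQ, ha⟩, hL', hS⟩ := exists_simple_subquotient
    (fun L : Ideal A => ∃ a ∉ Q, ∀ x ∈ L, a * x = 0) ⟨1, hQ.1, by simp⟩
    fun ⟨a, ha, h⟩ => ha (by simpa [← show a = 0 by simpa using h 1 trivial] using hQ0)
  refine ⟨_, _, _, hS, fun b hb => ?_⟩
  by_contra hbQ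
  have : ¬ ∀ c, a * c * b ∈ Q := fun h => (hQ.2 a b h).elim haQ hbQ
  push Not at this
  obtain ⟨c, hc⟩ := this
  refine hL' ⟨_, hc, fun x hx => ?_⟩
  have hbx := Module.mem_annihilator.mp hb (Submodule.mkQ _ ⟨x, hx⟩)
  rw [← map_smul, Submodule.mkQ_apply, Submodule.Quotient.mk_eq_zero] at hbx
  have hbx' : b * x ∈ L := hbx
  simpa [mul_assoc] using ha _ (L.mul_mem_left c hbx')

variable (A) in
/-- The annihilators of the simple modules. -/
def simpleAnnihilators : Set (Ideal A) :=
  {P | ∃ (S : Type u) (_ : AddCommGroup S) (_ : Module A S), IsSimpleModule A S ∧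
    P = Module.annihilator A S}

theorem eq_of_mem_simpleAnnihilators_of_le [IsArtinianRing A] {P P' : Ideal A}
    (hP : P ∈ simpleAnnihilators A) (hP' : P' ∈ simpleAnnihilators A) (h : P ≤ P') : P = P' := by
  obtain ⟨S, _, _, _, rfl⟩ := hP
  obtain ⟨T, _, _, _, rfl⟩ := hP'
  obtain ⟨e⟩ := nonempty_linearEquiv_of_annihilator_le h
  exact e.annihilator_eq

/-- By the descending chain condition some finite intersection of these ideals lies in all of them.
Primeness puts one member of the finite family inside any given annihilator, and such an inclusion
is an equality. -/
theorem finite_simpleAnnihilators [IsArtinianRing A] : (simpleAnnihilators A).Finite := by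
  classical
  obtain ⟨t, ht⟩ := Finset.exists_inf_le (fun P : simpleAnnihilators A => P.1)
  suffices h : ∀ P : simpleAnnihilators A, P ∈ t from
    @Set.toFinite _ _ (Fintype.finite ⟨t, h⟩)
  intro P
  have key : ∀ s : Finset (simpleAnnihilators A), (s.inf fun P => P.1) ≤ P.1 → P ∈ s := by
    have hprime : IsPrimeSet (P.1 : Set A) := by
      obtain ⟨_, S, _, _, _, rfl⟩ := P
      exact isPrimeSet_annihilator S
    intro s
    induction s using Finset.induction_on with
    | empty => exact fun h => absurd (h (Submodule.mem_top (x := 1))) hprime.1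
    | insert P' s _ ih =>
      intro h
      rw [Finset.inf_insert] at h
      by_cases hs : (s.inf fun P => P.1) ≤ P.1
      · exact Finset.mem_insert_of_mem (ih hs)
      · rw [SetLike.not_le_iff_exists] at hs
        obtain ⟨b, hb, hbP⟩ := hs
        have hle : P'.1 ≤ P.1 := fun a ha => by
          refine (hprime.2 a b fun c => h ⟨?_, Ideal.mul_mem_left _ _ hb⟩).resolve_right hbP
          obtain ⟨_, S, _, _, _, rfl⟩ := P'
          exact Ideal.mul_mem_right _ _ (Ideal.mul_mem_right _ _ ha)
        have : P' = P := Subtype.ext (eq_of_mem_simpleAnnihilators_of_le P'.2 P.2 hle)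
        exact this ▸ Finset.mem_insert_self _ _
  exact key t (ht P)

/-- A left artinian, left selfinjective ring contains a copy of every simple left module. -/
theorem exists_ne_zero_of_isSimpleModule [IsArtinianRing A] (hA : Module.Injective A A)
    (S : Type u) [AddCommGroup S] [Module A S] [IsSimpleModule A S] :
    ∃ f : S →ₗ[A] A, f ≠ 0 := by
  -- Every `P` is the dual annihilator of some simple `T`, and `P'` is the annihilator of `T`. The
  -- choice `P ↦ P'` is injective since `P'` determines `T`, hence `P`; on a finite set it is
  -- surjective, so every simple module has a proper dual annihilator.
  have key : ∀ P : simpleAnnihilators A, ∃ P' : simpleAnnihilators A, ∀ (T : Type u)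
      [AddCommGroup T] [Module A T] [IsSimpleModule A T], P'.1 = Module.annihilator A T →
        dualAnnihilator A T = P.1 := by
    rintro ⟨P, hP⟩
    have hprime : IsPrimeSet (P : Set A) := by
      obtain ⟨T, _, _, _, rfl⟩ := hP
      exact isPrimeSet_annihilator T
    obtain ⟨T, _, _, _, hT⟩ := exists_dualAnnihilator_subset hprime P.zero_mem
    obtain ⟨U, _, _, _, hU⟩ := exists_annihilator_subset
      (isPrimeSet_dualAnnihilator hA T fun h => hprime.1 (hT h)) (by simp [dualAnnihilator])
    have hUP := eq_of_mem_simpleAnnihilators_of_le ⟨U, _, _, ‹_›, rfl⟩ hP (hU.trans hT)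
    refine ⟨⟨Module.annihilator A T, T, _, _, ‹_›, rfl⟩, fun T' _ _ _ h => ?_⟩
    obtain ⟨e⟩ := nonempty_linearEquiv_of_annihilator_le h.le
    rw [← dualAnnihilator_congr e]
    exact hT.antisymm (hUP ▸ hU)
  choose τ hτ using key
  have : Finite (simpleAnnihilators A) := finite_simpleAnnihilators
  have hinj : Function.Injective τ := fun P P' h => by
    obtain ⟨T, _, _, _, hT⟩ := (τ P).2
    exact Subtype.ext (SetLike.coe_injective ((hτ P T hT).symm.trans (hτ P' T (h ▸ hT))))
  obtain ⟨⟨P, hP⟩, hPS⟩ := Finite.surjective_of_injective hinj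
    ⟨Module.annihilator A S, S, _, _, ‹_›, rfl⟩
  have hS := hτ ⟨P, hP⟩ S (by rw [hPS])
  have h1 : (1 : A) ∉ dualAnnihilator A S := by
    rw [hS]
    obtain ⟨T, _, _, _, rfl⟩ := hP
    exact (isPrimeSet_annihilator T).1
  by_contra! h0
  exact h1 fun f s => by simp [h0 f]

/-- Over a left artinian, left selfinjective ring every finitely generated module embeds into a
free module of finite rank. -/
theorem exists_injective_free [IsArtinianRing A] (hA : Module.Injective A A) (M : Type u)
    [AddCommGroup M] [Module A M] [Module.Finite A M] :
    ∃ (n : ℕ) (f : M →ₗ[A] (Fin n → A)), Function.Injective f := by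
  refine exists_injective_pi fun x hx => ?_
  let N := Submodule.span A {x}
  have : Nontrivial N := ⟨⟨x, Submodule.mem_span_singleton_self x⟩, 0, fun h => hx (by
    simpa using congrArg Subtype.val h)⟩
  -- The cyclic module `N` has a simple quotient, which maps nontrivially to `A`; the extension of
  -- this map to `M` cannot kill the generator `x`.
  obtain ⟨K, hK⟩ := IsCoatomic.exists_coatom (α := Submodule A N)
  have : IsSimpleModule A (N ⧸ K) := isSimpleModule_iff_isCoatom.mpr hK
  obtain ⟨f, hf⟩ := exists_ne_zero_of_isSimpleModule hA (N ⧸ K)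
  obtain ⟨g, hg⟩ := hA.out N.subtype N.injective_subtype (f ∘ₗ K.mkQ)
  refine ⟨g, fun h0 => hf ?_⟩
  ext y
  obtain ⟨y, hy⟩ := y
  obtain ⟨a, rfl⟩ := Submodule.mem_span_singleton.mp hy
  have := hg ⟨a • x, hy⟩
  simp only [Submodule.subtype_apply, map_smul, h0, smul_zero] at this
  simpa using this.symm

end SelfInjective
end MorphismCategory

namespace MorphismCategory

/-! ### Factoring maps through exact pairs -/

section Factorization

variable {A : Type u} [Ring A] {X Y Z W : Type*} [AddCommGroup X] [Module A X] [AddCommGroup Y]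
  [Module A Y] [AddCommGroup Z] [Module A Z] [AddCommGroup W] [Module A W]
  {i : X →ₗ[A] Y} {p : Y →ₗ[A] Z}

theorem exists_comp_eq_of_surjective (hp : Function.Surjective p) (h : Function.Exact i p)
    (q : Y →ₗ[A] W) (hq : q ∘ₗ i = 0) : ∃ v : Z →ₗ[A] W, ∀ y, v (p y) = q y := by
  refine ⟨(LinearMap.ker p).liftQ q (fun y hy => ?_) ∘ₗ
    (p.quotKerEquivOfSurjective hp).symm.toLinearMap, fun y => ?_⟩
  · obtain ⟨x, rfl⟩ := (h y).mp hy
    exact LinearMap.congr_fun hq x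
  · have : (p.quotKerEquivOfSurjective hp).symm (p y) = (LinearMap.ker p).mkQ y :=
      (LinearEquiv.symm_apply_eq _).mpr (by simp)
    simp [this]

theorem exists_comp_eq_of_injective (hi : Function.Injective i) (h : Function.Exact i p)
    (q : W →ₗ[A] Y) (hq : p ∘ₗ q = 0) : ∃ v : W →ₗ[A] X, ∀ w, i (v w) = q w := by
  refine ⟨(LinearEquiv.ofInjective i hi).symm.toLinearMap ∘ₗ
    q.codRestrict (LinearMap.range i) (fun w => (h _).mp (LinearMap.congr_fun hq w)), fun w => ?_⟩
  exact congrArg Subtype.val ((LinearEquiv.ofInjective i hi).apply_symm_apply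
    (q.codRestrict (LinearMap.range i) (fun w => (h _).mp (LinearMap.congr_fun hq w)) w))

end Factorization

/-! ### Projectives, injectives and envelopes -/

section Injectives

variable {A : Type u} [Ring A]

theorem injective_of_retract {M E : Type u} [AddCommGroup M] [Module A M] [AddCommGroup E]
    [Module A E] (hE : Module.Injective A E) (i : M →ₗ[A] E) (r : E →ₗ[A] M)
    (h : ∀ x, r (i x) = x) : Module.Injective A M where
  out X Y _ _ _ _ f hf g := by
    obtain ⟨k, hk⟩ := hE.out f hf (i ∘ₗ g)
    exact ⟨r ∘ₗ k, fun x => by simp [hk, h]⟩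

theorem injective_free (hA : Module.Injective A A) (n : ℕ) : Module.Injective A (Fin n → A) :=
  inferInstance

theorem injective_of_projective (hA : Module.Injective A A) (M : Type u) [AddCommGroup M]
    [Module A M] [Module.Finite A M] [Module.Projective A M] : Module.Injective A M := by
  obtain ⟨n, f, hf⟩ := Module.Finite.exists_fin' A M
  obtain ⟨s, hs⟩ := Module.projective_lifting_property f LinearMap.id hf
  exact injective_of_retract (injective_free hA n) s f (LinearMap.congr_fun hs)

theorem projective_of_injective [IsArtinianRing A] (hA : Module.Injective A A) {M : Type u}
    [AddCommGroup M] [Module A M] [Module.Finite A M] (hM : Module.Injective A M) :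
    Module.Projective A M := by
  obtain ⟨n, f, hf⟩ := exists_injective_free hA M
  obtain ⟨r, hr⟩ := hM.out f hf LinearMap.id
  exact Module.Projective.of_split f r (LinearMap.ext hr)

/-- A maximal essential extension of a submodule inside a noetherian injective module is
injective. -/
theorem injective_of_maximal_essential {F : Type u} [AddCommGroup F] [Module A F]
    [IsNoetherian A F] (hF : Module.Injective A F) (M E : Submodule A F)
    (hess : ∀ N ≤ E, Disjoint N M → N = ⊥)
    (hmax : ∀ E', E ≤ E' → (∀ N ≤ E', Disjoint N M → N = ⊥) → E' = E) :
    Module.Injective A E := by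
  -- For `C` maximal with `C ∩ E = 0`, the inclusion of `E` extends over `E → F/C` to `h`. The range
  -- of `h` is again essential over `M`, so it equals `E`, and `h` makes `E` a retract of `F`.
  obtain ⟨C, hC, hCmax⟩ := set_has_maximal_iff_noetherian.mpr ‹IsNoetherian A F›
    {C | Disjoint C E} ⟨⊥, disjoint_bot_left⟩
  have hCE : ∀ K, C ≤ K → Disjoint K E → K = C := fun K hK hd =>
    (hK.eq_or_lt.resolve_right (hCmax K hd)).symm
  obtain ⟨h, hh⟩ := hF.out (C.mkQ ∘ₗ E.subtype) ((injective_iff_map_eq_zero _).mpr fun x hx => by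
    have hxC : x.1 ∈ C := by simpa using hx
    exact Subtype.ext (Submodule.disjoint_def.mp hC x.1 hxC x.2)) E.subtype
  have hE : ∀ x ∈ E, h (C.mkQ x) = x := fun x hx => hh ⟨x, hx⟩
  have hle : E ≤ LinearMap.range h := fun x hx => ⟨_, hE x hx⟩
  have hdis : ∀ N ≤ LinearMap.range h, Disjoint N E → N = ⊥ := by
    intro N hN hd
    -- The preimage contains `C` and misses `E`, so maximality of `C` forces equality.
    have hcom : N.comap (h ∘ₗ C.mkQ) = C := by
      refine hCE _ (fun x hx => ?_) (Submodule.disjoint_def.mpr fun x hx hxE => ?_)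
      · have : C.mkQ x = 0 := by simpa using hx
        simp [-Submodule.mkQ_apply, this]
      · have hxN : h (C.mkQ x) ∈ N := hx
        rw [hE x hxE] at hxN
        exact Submodule.disjoint_def.mp hd x hxN hxE
    rw [eq_bot_iff]
    intro y hy
    obtain ⟨z, rfl⟩ := hN hy
    obtain ⟨x, rfl⟩ := C.mkQ_surjective z
    have hx : x ∈ N.comap (h ∘ₗ C.mkQ) := hy
    rw [hcom] at hx
    have : C.mkQ x = 0 := by simpa using hx
    simp [-Submodule.mkQ_apply, this]
  have hrange : LinearMap.range h = E := hmax _ hle fun N hN hd => by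
    refine hdis N hN (disjoint_iff.mpr (hess _ inf_le_right ?_))
    exact hd.mono_left inf_le_left
  refine injective_of_retract hF E.subtype
    ((h ∘ₗ C.mkQ).codRestrict E fun x => hrange ▸ LinearMap.mem_range_self h _) fun x => ?_
  exact Subtype.ext (hE x.1 x.2)

/-- Finitely generated injective envelopes over a selfinjective artinian ring. -/
theorem exists_isInjectiveEnvelope [IsArtinianRing A] (hA : Module.Injective A A) (M : Type u)
    [AddCommGroup M] [Module A M] [Module.Finite A M] :
    ∃ (E : FGModuleCat.{u} A) (f : M →ₗ[A] E), IsInjectiveEnvelope f := by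
  obtain ⟨n, f, hf⟩ := exists_injective_free hA M
  obtain ⟨E, ⟨hfE, hess⟩, hmax⟩ := set_has_maximal_iff_noetherian.mpr
    (inferInstance : IsNoetherian A (Fin n → A))
    {E | LinearMap.range f ≤ E ∧ ∀ N ≤ E, Disjoint N (LinearMap.range f) → N = ⊥}
    ⟨_, le_rfl, fun N hN h => by rwa [disjoint_of_le_iff_left_eq_bot hN] at h⟩
  refine ⟨FGModuleCat.of A E, f.codRestrict E fun x => hfE ⟨x, rfl⟩,
    injective_of_maximal_essential (injective_free hA n) _ E hess fun E' hE hE' =>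
      (hE.eq_or_lt.resolve_right (hmax E' ⟨hfE.trans hE, hE'⟩)).symm,
    fun x y h => hf (congrArg Subtype.val h), fun N hN => ?_⟩
  have hN' : N.map E.subtype = ⊥ := by
    refine hess _ (Submodule.map_subtype_le E N) (Submodule.disjoint_def.mpr ?_)
    rintro _ ⟨y, hy, rfl⟩ ⟨x, hx⟩
    have := Submodule.disjoint_def.mp hN y hy ⟨x, Subtype.ext hx⟩
    simp [this]
  exact Submodule.map_injective_of_injective E.injective_subtype
    (hN'.trans (Submodule.map_bot _).symm)

end Injectives

/-! ### Stable isomorphisms and the five lemma -/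

section StableIso

variable {A : Type u} [Ring A]

/-- A linear map of finitely generated modules that becomes invertible in the stable category. -/
def IsStableIso {M N : Type u} [AddCommGroup M] [Module A M] [Module.Finite A M]
    [AddCommGroup N] [Module A N] [Module.Finite A N] (f : M →ₗ[A] N) : Prop :=
  IsIso ((CategoryTheory.Quotient.functor (stableRel A)).map
    (FGModuleCat.ofHom f : FGModuleCat.of A M ⟶ FGModuleCat.of A N))

variable {M N Q K : Type u} [AddCommGroup M] [Module A M] [Module.Finite A M] [AddCommGroup N]
  [Module A N] [Module.Finite A N] [AddCommGroup Q] [Module A Q] [Module.Finite A Q]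
  [AddCommGroup K] [Module A K]

theorem functor_map_eq_of_sub_eq {X Y : FGModuleCat.{u} A} (f g : X ⟶ Y) (P : Type u)
    [AddCommGroup P] [Module A P] [Module.Finite A P] [Module.Projective A P]
    (a : X →ₗ[A] P) (b : P →ₗ[A] Y) (h : f.hom.hom - g.hom.hom = b ∘ₗ a) :
    (CategoryTheory.Quotient.functor (stableRel A)).map f =
      (CategoryTheory.Quotient.functor (stableRel A)).map g :=
  CategoryTheory.Quotient.sound _ ⟨FGModuleCat.of A P, FGModuleCat.ofHom a, FGModuleCat.ofHom b,
    inferInstanceAs (Module.Projective A P), FGModuleCat.hom_ext h⟩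

theorem isStableIso_of_exists {f : M →ₗ[A] N} (g : N →ₗ[A] M) (P P' : Type u) [AddCommGroup P]
    [Module A P] [Module.Finite A P] [Module.Projective A P] [AddCommGroup P']
    [Module A P'] [Module.Finite A P'] [Module.Projective A P'] (a : M →ₗ[A] P) (b : P →ₗ[A] M)
    (h : g ∘ₗ f - LinearMap.id = b ∘ₗ a) (a' : N →ₗ[A] P') (b' : P' →ₗ[A] N)
    (h' : f ∘ₗ g - LinearMap.id = b' ∘ₗ a') : IsStableIso f := by
  refine ⟨(CategoryTheory.Quotient.functor (stableRel A)).map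
    (FGModuleCat.ofHom g : FGModuleCat.of A N ⟶ FGModuleCat.of A M), ?_, ?_⟩
  · rw [← Functor.map_comp, ← CategoryTheory.Functor.map_id]
    exact functor_map_eq_of_sub_eq _ _ P a b h
  · rw [← Functor.map_comp, ← CategoryTheory.Functor.map_id]
    exact functor_map_eq_of_sub_eq _ _ P' a' b' h'

theorem IsStableIso.exists {f : M →ₗ[A] N} (hf : IsStableIso f) : ∃ g : N →ₗ[A] M,
    (∃ (P : FGModuleCat.{u} A) (a : M →ₗ[A] P) (b : P →ₗ[A] M), Module.Projective A P ∧
      g ∘ₗ f - LinearMap.id = b ∘ₗ a) ∧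
    ∃ (P : FGModuleCat.{u} A) (a : N →ₗ[A] P) (b : P →ₗ[A] N), Module.Projective A P ∧
      f ∘ₗ g - LinearMap.id = b ∘ₗ a := by
  obtain ⟨k, h, h'⟩ := hf
  obtain ⟨g, rfl⟩ := (CategoryTheory.Quotient.functor (stableRel A)).map_surjective k
  rw [← Functor.map_comp, ← CategoryTheory.Functor.map_id,
    CategoryTheory.Quotient.functor_map_eq_iff] at h h'
  obtain ⟨P, a, b, hP, h⟩ := h
  obtain ⟨P', a', b', hP', h'⟩ := h'
  exact ⟨g.hom.hom, ⟨P, a.hom.hom, b.hom.hom, hP, congrArg (fun k => k.hom.hom) h⟩,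
    ⟨P', a'.hom.hom, b'.hom.hom, hP', congrArg (fun k => k.hom.hom) h'⟩⟩

theorem IsStableIso.comp {f : M →ₗ[A] N} {g : N →ₗ[A] Q} (hf : IsStableIso f)
    (hg : IsStableIso g) : IsStableIso (g ∘ₗ f) := by
  have hf' : IsIso _ := hf
  have hg' : IsIso _ := hg
  have h : IsIso ((CategoryTheory.Quotient.functor (stableRel A)).map (FGModuleCat.ofHom f) ≫
      (CategoryTheory.Quotient.functor (stableRel A)).map (FGModuleCat.ofHom g)) :=
    IsIso.comp_isIso' hf' hg'
  rw [← Functor.map_comp] at h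
  exact h

theorem IsStableIso.of_comp {f : M →ₗ[A] N} {g : N →ₗ[A] Q} (h : IsStableIso (g ∘ₗ f))
    (hg : IsStableIso g) : IsStableIso f := by
  have hg' : IsIso _ := hg
  have h' : IsIso ((CategoryTheory.Quotient.functor (stableRel A)).map (FGModuleCat.ofHom f) ≫
      (CategoryTheory.Quotient.functor (stableRel A)).map (FGModuleCat.ofHom g)) := by
    rw [← Functor.map_comp]
    exact h
  exact IsIso.of_isIso_comp_right _
    ((CategoryTheory.Quotient.functor (stableRel A)).map (FGModuleCat.ofHom g))

/-- The sequence splits: the retraction `g` is a strict left inverse, and `f ∘ g` differs from the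
identity by a map through `Q`. -/
theorem isStableIso_of_projective_cokernel {f : M →ₗ[A] N} {r : N →ₗ[A] Q}
    (hf : Function.Injective f) (hr : Function.Surjective r) (h : Function.Exact f r)
    [Module.Projective A Q] : IsStableIso f := by
  obtain ⟨s, hs⟩ := Module.projective_lifting_property r LinearMap.id hr
  have hs' : ∀ q, r (s q) = q := LinearMap.congr_fun hs
  obtain ⟨g, hg⟩ := exists_comp_eq_of_injective hf h (LinearMap.id - s ∘ₗ r)
    (LinearMap.ext fun x => by simp [hs'])
  refine isStableIso_of_exists g Q Q 0 0 (LinearMap.ext fun x => hf ?_) r (-s)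
    (LinearMap.ext fun x => ?_)
  · simp [hg, h.apply_apply_eq_zero]
  · simp [hg]

theorem isStableIso_of_injective_kernel [IsArtinianRing A] (hA : Module.Injective A A)
    {k : K →ₗ[A] M} {f : M →ₗ[A] N} (hk : Function.Injective k) (hf : Function.Surjective f)
    (h : Function.Exact k f) (hK : Module.Injective A K) : IsStableIso f := by
  have : Module.Finite A K := Module.Finite.of_injective k hk
  have := projective_of_injective hA hK
  obtain ⟨s, hs⟩ := hK.out k hk LinearMap.id
  obtain ⟨g, hg⟩ := exists_comp_eq_of_surjective hf h (LinearMap.id - k ∘ₗ s)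
    (LinearMap.ext fun x => by simp [hs])
  refine isStableIso_of_exists g K K s (-k) (LinearMap.ext fun x => ?_) 0 0
    (LinearMap.ext fun x => ?_)
  · simp [hg]
  · obtain ⟨y, rfl⟩ := hf x
    simp [hg, h.apply_apply_eq_zero]

theorem isStableIso_fst [IsArtinianRing A] (hA : Module.Injective A A)
    (hQ : Module.Injective A Q) : IsStableIso (LinearMap.fst A M Q) :=
  isStableIso_of_injective_kernel hA (k := LinearMap.inr A M Q) LinearMap.inr_injective
    LinearMap.fst_surjective (LinearMap.exact_iff.mpr (LinearMap.range_inr A M Q).symm) hQ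

/-- The stable inverse can be corrected to a strict retraction of `f`, so `C` embeds in `N` by a
section `s`; the factorization of `f ∘ g - id` then exhibits `C` as a retract of a projective. -/
theorem IsStableIso.projective_cokernel (hA : Module.Injective A A) {C : Type u}
    [AddCommGroup C] [Module A C] {f : M →ₗ[A] N} {r : N →ₗ[A] C}
    (hst : IsStableIso f) (hf : Function.Injective f)
    (hr : Function.Surjective r) (h : Function.Exact f r) : Module.Projective A C := by
  obtain ⟨g, ⟨P, a, b, hP, hgf⟩, P', a', b', hP', hfg⟩ := hst.exists
  -- As `P` is injective, `a` extends over `f`, and `g - b ∘ c` is a strict left inverse of `f`.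
  obtain ⟨c, hc⟩ := (injective_of_projective hA P).out f hf a
  obtain ⟨s, hs⟩ := exists_comp_eq_of_surjective hr h
    (LinearMap.id - f ∘ₗ (g - b ∘ₗ c)) (LinearMap.ext fun x => by
      have := LinearMap.congr_fun hgf x
      simp only [LinearMap.sub_apply, LinearMap.comp_apply, LinearMap.id_apply] at this
      simp [hc, ← this])
  -- Since `r ∘ f = 0`, applying `r` to `(f ∘ g - id) ∘ s` leaves minus the identity; hence the
  -- sign.
  refine Module.Projective.of_split (-(a' ∘ₗ s)) (r ∘ₗ b') (LinearMap.ext fun x => ?_)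
  have hrs : r (s x) = x := by
    obtain ⟨y, rfl⟩ := hr x
    simp [hs, h.apply_apply_eq_zero]
  have := congrArg r (LinearMap.congr_fun hfg (s x))
  simp only [LinearMap.sub_apply, LinearMap.comp_apply, LinearMap.id_apply, map_sub,
    h.apply_apply_eq_zero, hrs, zero_sub] at this
  simp [← this]

/-- An injective summand in the target is stably invisible. Taking `g` injective turns a stable
isomorphism into a monomorphism. -/
theorem IsStableIso.prod [IsArtinianRing A] (hA : Module.Injective A A) {f : M →ₗ[A] N}
    (hf : IsStableIso f) (hQ : Module.Injective A Q) (g : M →ₗ[A] Q) :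
    IsStableIso (f.prod g) := by
  exact IsStableIso.of_comp (g := LinearMap.fst A N Q) (by simpa using hf) (isStableIso_fst hA hQ)

/-- The five lemma for the stable category: in a ladder of short exact sequences with two stable
isomorphisms on the left, the third map is a stable isomorphism. -/
theorem isStableIso_of_exact [IsArtinianRing A] (hA : Module.Injective A A)
    {X Y Z X' Y' Z' : Type u} [AddCommGroup X] [Module A X] [Module.Finite A X]
    [AddCommGroup Y] [Module A Y] [Module.Finite A Y] [AddCommGroup Z] [Module A Z]
    [Module.Finite A Z] [AddCommGroup X'] [Module A X'] [Module.Finite A X'] [AddCommGroup Y']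
    [Module A Y'] [Module.Finite A Y'] [AddCommGroup Z'] [Module A Z'] [Module.Finite A Z']
    {i : X →ₗ[A] Y} {p : Y →ₗ[A] Z} (hi : Function.Injective i) (hp : Function.Surjective p)
    (h : Function.Exact i p) {i' : X' →ₗ[A] Y'} {p' : Y' →ₗ[A] Z'} (hi' : Function.Injective i')
    (hp' : Function.Surjective p') (h' : Function.Exact i' p') {a : X →ₗ[A] X'}
    {b : Y →ₗ[A] Y'} {c : Z →ₗ[A] Z'} (hab : ∀ x, b (i x) = i' (a x))
    (hbc : ∀ y, c (p y) = p' (b y)) (ha : IsStableIso a) (hb : IsStableIso b) :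
    IsStableIso c := by
  -- With `F` this free module, `b` is replaced by the monomorphism `(b, e) : Y → Y' ⊕ F`, and `c`
  -- factors as `Z → (Y' ⊕ F)/X → Z'`.
  obtain ⟨n, e, he⟩ := exists_injective_free hA Y
  have hfree := injective_free hA n
  let α : X →ₗ[A] Y' × (Fin n → A) := b.prod e ∘ₗ i
  obtain ⟨v, hv⟩ := exists_comp_eq_of_surjective hp h ((LinearMap.range α).mkQ ∘ₗ b.prod e)
    (LinearMap.ext fun x => (Submodule.Quotient.mk_eq_zero _).mpr ⟨x, rfl⟩)
  have hα : Function.Exact α (LinearMap.range α).mkQ := LinearMap.exact_map_mkQ_range α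
  obtain ⟨w, hw⟩ := exists_comp_eq_of_surjective (LinearMap.range α).mkQ_surjective hα
    (p' ∘ₗ LinearMap.fst A Y' (Fin n → A)) (LinearMap.ext fun x => by
      simp [α, hab, h'.apply_apply_eq_zero])
  have hvw : c = w ∘ₗ v := LinearMap.ext fun z => by
    obtain ⟨y, rfl⟩ := hp z
    rw [LinearMap.comp_apply, hv, LinearMap.comp_apply, hw, hbc]
    rfl
  rw [hvw]
  refine IsStableIso.comp ?_ ?_
  -- The first factor is injective with cokernel that of the monic stable isomorphism `β`, hence
  -- projective.
  · let β : Y →ₗ[A] Y' × (Fin n → A) := b.prod e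
    obtain ⟨r, hr⟩ := exists_comp_eq_of_surjective (LinearMap.range α).mkQ_surjective hα
      (LinearMap.range β).mkQ (LinearMap.ext fun x =>
        (Submodule.Quotient.mk_eq_zero _).mpr ⟨i x, rfl⟩)
    have hproj : Module.Projective A ((Y' × (Fin n → A)) ⧸ LinearMap.range β) :=
      (hb.prod hA hfree e).projective_cokernel hA (fun x y hxy => he (congrArg Prod.snd hxy))
        (LinearMap.range β).mkQ_surjective (LinearMap.exact_map_mkQ_range β)
    refine isStableIso_of_projective_cokernel (r := r) ?_ (fun z => ?_) (fun z => ⟨fun hz => ?_, ?_⟩)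
    · refine (injective_iff_map_eq_zero v).mpr fun z hz => ?_
      obtain ⟨y, rfl⟩ := hp z
      rw [hv] at hz
      obtain ⟨x, hx⟩ := (Submodule.Quotient.mk_eq_zero _).mp hz
      rw [← he (congrArg Prod.snd hx), h.apply_apply_eq_zero]
    · obtain ⟨y, rfl⟩ := (LinearMap.range β).mkQ_surjective z
      exact ⟨_, hr y⟩
    · obtain ⟨y, rfl⟩ := (LinearMap.range α).mkQ_surjective z
      rw [hr] at hz
      obtain ⟨x, rfl⟩ := (Submodule.Quotient.mk_eq_zero _).mp hz
      exact ⟨p x, hv x⟩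
    · rintro ⟨x, rfl⟩
      obtain ⟨y, rfl⟩ := hp x
      rw [hv, LinearMap.comp_apply, hr]
      exact (Submodule.Quotient.mk_eq_zero _).mpr ⟨y, rfl⟩
  -- The second factor is surjective with kernel the cokernel of the monic stable isomorphism `γ`,
  -- which is projective and so injective.
  · let γ : X →ₗ[A] X' × (Fin n → A) := a.prod (e ∘ₗ i)
    have hγα : ∀ x, i'.prodMap LinearMap.id (γ x) = α x := fun x => by simp [γ, α, hab]
    have hγ : Function.Exact γ (LinearMap.range γ).mkQ := LinearMap.exact_map_mkQ_range γ
    obtain ⟨k, hk⟩ := exists_comp_eq_of_surjective (LinearMap.range γ).mkQ_surjective hγ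
      ((LinearMap.range α).mkQ ∘ₗ i'.prodMap LinearMap.id) (LinearMap.ext fun x =>
        (Submodule.Quotient.mk_eq_zero _).mpr ⟨x, (hγα x).symm⟩)
    have hproj : Module.Projective A ((X' × (Fin n → A)) ⧸ LinearMap.range γ) :=
      (ha.prod hA hfree (e ∘ₗ i)).projective_cokernel hA
        (fun x y hxy => hi (he (congrArg Prod.snd hxy)))
        (LinearMap.range γ).mkQ_surjective (LinearMap.exact_map_mkQ_range γ)
    refine isStableIso_of_injective_kernel hA (k := k) ?_ (fun z => ?_) (fun z => ⟨fun hz => ?_, ?_⟩)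
      (injective_of_projective hA _)
    · refine (injective_iff_map_eq_zero k).mpr fun z hz => ?_
      obtain ⟨y, rfl⟩ := (LinearMap.range γ).mkQ_surjective z
      rw [hk] at hz
      obtain ⟨x, hx⟩ := (Submodule.Quotient.mk_eq_zero _).mp hz
      rw [← hγα] at hx
      refine (Submodule.Quotient.mk_eq_zero _).mpr ⟨x, ?_⟩
      exact Prod.ext (hi' (congrArg Prod.fst hx :)) (congrArg Prod.snd hx :)
    · obtain ⟨y, rfl⟩ := hp' z
      exact ⟨(LinearMap.range α).mkQ (y, 0), hw _⟩
    · obtain ⟨⟨y, t⟩, rfl⟩ := (LinearMap.range α).mkQ_surjective z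
      rw [hw] at hz
      obtain ⟨x, rfl⟩ := (h' y).mp hz
      exact ⟨(LinearMap.range γ).mkQ (x, t), hk _⟩
    · rintro ⟨x, rfl⟩
      obtain ⟨y, rfl⟩ := (LinearMap.range γ).mkQ_surjective x
      rw [hk, LinearMap.comp_apply, hw]
      exact h'.apply_apply_eq_zero _

end StableIso
end MorphismCategory

noncomputable section
namespace MorphismCategory

/-! ### Lifting stable ladders -/

section Ladder

variable {A : Type u} [Ring A] {N : ℕ}

theorem isIso_functor_map_iff {X Y : FGModuleCat.{u} A} (f : X ⟶ Y) :
    IsIso ((CategoryTheory.Quotient.functor (stableRel A)).map f) ↔ IsStableIso f.hom.hom :=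
  Iff.rfl

/-- A morphism of chains given by a family of maps commuting with all steps. -/
def ladder {X Y : ComposableArrows (FGModuleCat.{u} A) N} (f : ∀ k, X.obj k ⟶ Y.obj k)
    (w : ∀ k : Fin N, step X k ≫ f k.succ = f k.castSucc ≫ step Y k) : X ⟶ Y :=
  ComposableArrows.homMk f fun i hi => w ⟨i, hi⟩

theorem step_mkOfObjOfMapSucc (Y : Fin (N + 1) → FGModuleCat.{u} A)
    (p : ∀ k : Fin N, Y k.castSucc ⟶ Y k.succ) (k : Fin N) :
    step (ComposableArrows.mkOfObjOfMapSucc Y p) k = p k :=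
  ComposableArrows.mkOfObjOfMapSucc_map_succ Y p k.1 k.2

/-- A commutative square in the stable category starting in a monomorphism can be made
commutative by changing the representative on its target side. -/
theorem exists_lift_square (hA : Module.Injective A A) {X X' Y Y' : FGModuleCat.{u} A} (i : X ⟶ X')
    (hi : Function.Injective i.hom.hom) (j : Y ⟶ Y') (f : X ⟶ Y)
    (β : (CategoryTheory.Quotient.functor (stableRel A)).obj X' ⟶
      (CategoryTheory.Quotient.functor (stableRel A)).obj Y')
    (h : (CategoryTheory.Quotient.functor (stableRel A)).map i ≫ β =
      (CategoryTheory.Quotient.functor (stableRel A)).map f ≫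
        (CategoryTheory.Quotient.functor (stableRel A)).map j) :
    ∃ f' : X' ⟶ Y', (CategoryTheory.Quotient.functor (stableRel A)).map f' = β ∧
      i ≫ f' = f ≫ j := by
  obtain ⟨g, rfl⟩ := (CategoryTheory.Quotient.functor (stableRel A)).map_surjective β
  rw [← Functor.map_comp, ← Functor.map_comp, CategoryTheory.Quotient.functor_map_eq_iff] at h
  obtain ⟨P, a, b, hP, hab⟩ := h
  -- The defect `a ≫ b` extends over `i` to `c ≫ b`; subtracting this repairs the square without
  -- changing the stable class of `g`.
  obtain ⟨c, hc⟩ := (injective_of_projective hA P).out i.hom.hom hi a.hom.hom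
  have hc' : i ≫ FGModuleCat.ofHom c = a := FGModuleCat.hom_ext (LinearMap.ext hc)
  refine ⟨g - FGModuleCat.ofHom c ≫ b,
    CategoryTheory.Quotient.sound _ ⟨P, -FGModuleCat.ofHom c, b, hP, by simp⟩, ?_⟩
  rw [Preadditive.comp_sub, ← Category.assoc, hc', ← hab, sub_sub_cancel]

/-- A stable ladder starting at a chain of monomorphisms is the image of a ladder. -/
theorem exists_stabilize_map_eq (hA : Module.Injective A A)
    {X Y : ComposableArrows (FGModuleCat.{u} A) N}
    (hX : ∀ k, Function.Injective (step X k).hom.hom)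
    (β : (stabilize A N).obj X ⟶ (stabilize A N).obj Y) :
    ∃ f : X ⟶ Y, (stabilize A N).map f = β := by
  let F := CategoryTheory.Quotient.functor (stableRel A)
  have key : ∀ (k : Fin N) (f : {f : X.obj k.castSucc ⟶ Y.obj k.castSucc //
      F.map f = β.app k.castSucc}), ∃ f' : {f : X.obj k.succ ⟶ Y.obj k.succ //
        F.map f = β.app k.succ}, step X k ≫ f'.1 = f.1 ≫ step Y k := by
    rintro k ⟨f, hf⟩
    obtain ⟨f', h, h'⟩ := exists_lift_square hA (step X k) (hX k) (step Y k) f (β.app k.succ)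
      ((β.naturality _).trans (by rw [← hf]; rfl))
    exact ⟨⟨f', h⟩, h'⟩
  choose next hnext using key
  obtain ⟨f₀, hf₀⟩ := F.map_surjective (β.app 0)
  -- The lifts are built recursively from `X_n` towards `X_1`, since each correction is made at the
  -- target of a step.
  let f : ∀ k : Fin (N + 1), {f : X.obj k ⟶ Y.obj k // F.map f = β.app k} :=
    fun k => Fin.induction ⟨f₀, hf₀⟩ next k
  have hf : ∀ k : Fin N, f k.succ = next k (f k.castSucc) := fun k => Fin.induction_succ _ _ k
  refine ⟨ladder (fun k => (f k).1) fun k => by rw [hf, hnext], ?_⟩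
  apply NatTrans.ext
  funext k
  exact (f k).2

end Ladder

/-! ### The chain of monomorphisms `Mimo X` -/

section Mimo

variable {A : Type u} [Ring A] {N : ℕ} {X : ComposableArrows (FGModuleCat.{u} A) N}

theorem nonempty_mimoData [IsArtinianRing A] (hA : Module.Injective A A)
    (X : ComposableArrows (FGModuleCat.{u} A) N) : Nonempty (MimoData X) := by
  have key : ∀ k : Fin N, ∃ (E : FGModuleCat.{u} A) (e : X.obj k.castSucc ⟶ E),
      IsInjectiveEnvelope (e.hom.hom ∘ₗ (LinearMap.ker (step X k).hom.hom).subtype) := by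
    intro k
    obtain ⟨E, f, hf⟩ := exists_isInjectiveEnvelope hA (LinearMap.ker (step X k).hom.hom)
    obtain ⟨e, he⟩ := hf.injective_module.out (LinearMap.ker (step X k).hom.hom).subtype
      (Submodule.injective_subtype _) f
    have : e ∘ₗ (LinearMap.ker (step X k).hom.hom).subtype = f := LinearMap.ext he
    exact ⟨E, FGModuleCat.ofHom e, this.symm ▸ hf⟩
  choose E e h using key
  exact ⟨⟨E, e, h⟩⟩

namespace MimoData

variable (M : MimoData X)

/-- The first coordinate of a kernel element lies in `Ker φ`, where `e` is injective; the remaining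
coordinates are merely copied. -/
theorem injective_step_mimo (k : Fin N) : Function.Injective (step M.mimo k).hom.hom := by
  rw [show step M.mimo k = M.theta k from step_mkOfObjOfMapSucc _ _ k]
  refine (injective_iff_map_eq_zero (M.thetaLin k)).mpr fun ⟨x, c⟩ h => ?_
  have hx : (step X k).hom.hom x = 0 := congrArg Prod.fst h
  have he : (M.e k).hom.hom x = 0 := by
    simpa [thetaLin] using congrFun (congrArg Prod.snd h) (Fin.last k.1)
  have hc : c = 0 := funext fun j => by
    simpa [thetaLin] using congrFun (congrArg Prod.snd h) j.castSucc
  have hx0 : (⟨x, hx⟩ : LinearMap.ker (step X k).hom.hom) = 0 :=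
    (M.envelope k).injective (he.trans (map_zero _).symm)
  exact Prod.ext (congrArg Subtype.val hx0) hc

/-- The projection of `Mimo X` onto `X`. -/
def proj : M.mimo ⟶ X :=
  ladder (fun k => FGModuleCat.ofHom (LinearMap.fst A _ _)) fun k => by
    rw [show step M.mimo k = M.theta k from step_mkOfObjOfMapSucc _ _ k]
    rfl

theorem isStableIso_proj [IsArtinianRing A] (hA : Module.Injective A A) (k : Fin (N + 1)) :
    IsStableIso (M.proj.app k).hom.hom := by
  have hinj : ∀ j : Fin k.1, Module.Injective A (M.IKer (Fin.castLE (Nat.le_of_lt_succ k.2) j)) :=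
    fun j => (M.envelope _).injective_module
  exact isStableIso_fst (M := X.obj k)
    (Q := ∀ j : Fin k.1, M.IKer (Fin.castLE (Nat.le_of_lt_succ k.2) j)) hA inferInstance

end MimoData

theorem isIso_stabilize_map {X Y : ComposableArrows (FGModuleCat.{u} A) N} (f : X ⟶ Y)
    (hf : ∀ k, IsStableIso (f.app k).hom.hom) : IsIso ((stabilize A N).map f) := by
  have : ∀ k, IsIso (((stabilize A N).map f).app k) := hf
  exact NatIso.isIso_of_isIso_app _

theorem isStableIso_app {X Y : ComposableArrows (FGModuleCat.{u} A) N} (f : X ⟶ Y)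
    [IsIso ((stabilize A N).map f)] (k : Fin (N + 1)) : IsStableIso (f.app k).hom.hom :=
  inferInstanceAs (IsIso (((stabilize A N).map f).app k))

end Mimo

end MorphismCategory
end

noncomputable section
namespace MorphismCategory

/-! ### Pushouts as cokernels -/

section Pushout

variable {A : Type u} [Ring A]

theorem isPushout_quotient {X B I : FGModuleCat.{u} A} (l : X ⟶ B) (h : X ⟶ I) :
    IsPushout l h
      (FGModuleCat.ofHom ((LinearMap.range (l.hom.hom.prod (-h.hom.hom))).mkQ ∘ₗ
        LinearMap.inl A B I) :
        B ⟶ FGModuleCat.of A ((B × I) ⧸ LinearMap.range (l.hom.hom.prod (-h.hom.hom))))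
      (FGModuleCat.ofHom ((LinearMap.range (l.hom.hom.prod (-h.hom.hom))).mkQ ∘ₗ
        LinearMap.inr A B I)) := by
  refine ⟨⟨FGModuleCat.hom_ext (LinearMap.ext fun x => ?_)⟩,
    ⟨Limits.PushoutCocone.IsColimit.mk _ (fun s => FGModuleCat.ofHom (Submodule.liftQ _
      (s.inl.hom.hom.coprod s.inr.hom.hom) ?_)) (fun s => ?_) (fun s => ?_) (fun s m h₁ h₂ => ?_)⟩⟩
  · exact (Submodule.Quotient.eq _).mpr ⟨x, Prod.ext (sub_zero _).symm (zero_sub _).symm⟩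
  · rintro _ ⟨x, rfl⟩
    have : s.inl.hom.hom (l.hom.hom x) = s.inr.hom.hom (h.hom.hom x) :=
      LinearMap.congr_fun (congrArg (fun k => k.hom.hom) s.condition) x
    simp [this]
  · refine FGModuleCat.hom_ext (LinearMap.ext fun x => ?_)
    change s.inl.hom.hom x + s.inr.hom.hom 0 = s.inl.hom.hom x
    simp
  · refine FGModuleCat.hom_ext (LinearMap.ext fun x => ?_)
    change s.inl.hom.hom 0 + s.inr.hom.hom x = s.inr.hom.hom x
    simp
  · refine FGModuleCat.hom_ext (Submodule.linearMap_qext _ (LinearMap.prod_ext ?_ ?_))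
    · refine LinearMap.ext fun x => ?_
      refine (LinearMap.congr_fun (congrArg (fun k => k.hom.hom) h₁) x).trans ?_
      change s.inl.hom.hom x = s.inl.hom.hom x + s.inr.hom.hom 0
      simp
    · refine LinearMap.ext fun x => ?_
      refine (LinearMap.congr_fun (congrArg (fun k => k.hom.hom) h₂) x).trans ?_
      change s.inr.hom.hom x = s.inl.hom.hom 0 + s.inr.hom.hom x
      simp

variable {X B I Y : FGModuleCat.{u} A} {l : X ⟶ B} {h : X ⟶ I} {g : B ⟶ Y} {j : I ⟶ Y}

theorem coprod_surjective_of_isPushout (sq : IsPushout l h g j) :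
    Function.Surjective (g.hom.hom.coprod j.hom.hom) := by
  let U := LinearMap.range (g.hom.hom.coprod j.hom.hom)
  let q : Y ⟶ FGModuleCat.of A (Y ⧸ U) := FGModuleCat.ofHom U.mkQ
  have hq : q = 0 := by
    refine sq.hom_ext (FGModuleCat.hom_ext (LinearMap.ext fun x => ?_))
      (FGModuleCat.hom_ext (LinearMap.ext fun x => ?_))
    · exact (Submodule.Quotient.mk_eq_zero U).mpr ⟨(x, 0), by simp [map_zero]; rfl⟩
    · exact (Submodule.Quotient.mk_eq_zero U).mpr ⟨(0, x), by simp [map_zero]; rfl⟩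
  exact fun y => (Submodule.Quotient.mk_eq_zero U).mp
    (LinearMap.congr_fun (congrArg (fun k => k.hom.hom) hq) y)

/-- An arbitrary pushout maps to the explicit quotient model, so a pair vanishing in `Y` vanishes
there too and hence comes from `X`. -/
theorem exact_of_isPushout (sq : IsPushout l h g j) :
    Function.Exact (l.hom.hom.prod (-h.hom.hom)) (g.hom.hom.coprod j.hom.hom) := by
  have hw : ∀ x, g.hom.hom (l.hom.hom x) = j.hom.hom (h.hom.hom x) := fun x =>
    LinearMap.congr_fun (congrArg (fun k => k.hom.hom) sq.w) x
  rintro ⟨b, x⟩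
  refine ⟨fun hbx => ?_, ?_⟩
  · have sq' := isPushout_quotient l h
    let d := sq.desc _ _ sq'.w
    have h₁ := LinearMap.congr_fun (congrArg (fun k => k.hom.hom) (sq.inl_desc _ _ sq'.w)) b
    have h₂ := LinearMap.congr_fun (congrArg (fun k => k.hom.hom) (sq.inr_desc _ _ sq'.w)) x
    have h₃ : d.hom.hom (g.hom.hom b) + d.hom.hom (j.hom.hom x) = 0 := by
      rw [← map_add]
      exact (congrArg d.hom.hom hbx).trans (map_zero _)
    refine (Submodule.Quotient.mk_eq_zero _).mp
      ((?_ : _ = d.hom.hom (g.hom.hom b) + d.hom.hom (j.hom.hom x)).trans h₃)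
    refine Eq.trans ?_ (congrArg₂ (· + ·) h₁ h₂).symm
    change _ = Submodule.Quotient.mk ((b, 0) + (0, x))
    simp
  · rintro ⟨y, hy⟩
    rw [← hy]
    simp [hw]

end Pushout

/-! ### Invariance of the rotation and its cokernel form -/

section Rotation

variable {A : Type u} [Ring A] {m : ℕ}

/-- A chain is determined by its successive arrows, so these can be lifted one at a time through the
full quotient functor. The objects are unchanged, which gives an equality as `rep_eq` demands. -/
theorem exists_stabilize_obj_eq {N : ℕ} (S : ComposableArrows (StMod A) N) :
    ∃ X : ComposableArrows (FGModuleCat.{u} A) N, (stabilize A N).obj X = S := by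
  let F := CategoryTheory.Quotient.functor (stableRel A)
  have key : ∀ k : Fin N, ∃ f : (S.obj k.castSucc).as ⟶ (S.obj k.succ).as,
      F.map f = S.map (homOfLE (Fin.castSucc_lt_succ).le) := fun k =>
    CategoryTheory.Functor.map_surjective F (X := (S.obj k.castSucc).as)
      (Y := (S.obj k.succ).as) _
  choose f hf using key
  refine ⟨ComposableArrows.mkOfObjOfMapSucc (fun k => (S.obj k).as) f,
    ComposableArrows.ext (fun k => rfl) fun i hi => ?_⟩
  refine Eq.trans ?_ ((Category.id_comp _).trans (Category.comp_id _)).symm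
  exact (congrArg F.map (step_mkOfObjOfMapSucc (fun k => (S.obj k).as) f ⟨i, hi⟩)).trans
    (hf ⟨i, hi⟩)

/-- Prescribing the representative allows a rotation to be formed from `Mimo X` itself. -/
theorem exists_rotationData [IsArtinianRing A] (hA : Module.Injective A A)
    (X : ComposableArrows (FGModuleCat.{u} A) (m + 1)) :
    ∃ D : RotationData ((stabilize A (m + 1)).obj X), D.rep = X := by
  have key : ∀ k : Fin (m + 1), ∃ (E : FGModuleCat.{u} A) (h : X.obj k.castSucc ⟶ E),
      IsInjectiveEnvelope h.hom.hom := by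
    intro k
    obtain ⟨E, f, hf⟩ := exists_isInjectiveEnvelope hA (X.obj k.castSucc)
    exact ⟨E, FGModuleCat.ofHom f, hf⟩
  choose E h hE using key
  have key : ∀ k : Fin m, ∃ s : E k.castSucc ⟶ E k.succ,
      h k.castSucc ≫ s = step X k.castSucc ≫ h k.succ := by
    intro k
    obtain ⟨s, hs⟩ := (hE k.succ).injective_module.out (h k.castSucc).hom.hom
      (hE k.castSucc).injective (step X k.castSucc ≫ h k.succ).hom.hom
    exact ⟨FGModuleCat.ofHom s, FGModuleCat.hom_ext (LinearMap.ext hs)⟩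
  choose s hs using key
  exact ⟨⟨X, rfl, E, h, hE, _, _, _, fun k => isPushout_quotient _ _, s, hs⟩, rfl⟩

namespace RotationData

variable {S T : ComposableArrows (StMod A) (m + 1)} (D : RotationData S) (E : RotationData T)

theorem g_psi (k : Fin m) : D.g k.castSucc ≫ D.psi k = D.g k.succ :=
  (D.isPushout k.castSucc).inl_desc _ _ _

theorem j_psi (k : Fin m) : D.j k.castSucc ≫ D.psi k = D.s k ≫ D.j k.succ :=
  (D.isPushout k.castSucc).inr_desc _ _ _

theorem g_psi_assoc (k : Fin m) {Z : FGModuleCat.{u} A} (f : D.Y k.succ ⟶ Z) :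
    D.g k.castSucc ≫ D.psi k ≫ f = D.g k.succ ≫ f := by
  rw [← Category.assoc, g_psi]

theorem j_psi_assoc (k : Fin m) {Z : FGModuleCat.{u} A} (f : D.Y k.succ ⟶ Z) :
    D.j k.castSucc ≫ D.psi k ≫ f = D.s k ≫ D.j k.succ ≫ f := by
  rw [← Category.assoc, j_psi, Category.assoc]

/-- The squares between pushouts are only required to commute stably, because maps of pushouts built
from chosen extensions commute only up to projectives. -/
theorem nonempty_rot_iso_stabilize (W : ComposableArrows (FGModuleCat.{u} A) m)
    (B : FGModuleCat.{u} A) (z : B ⟶ W.obj 0) (a : D.rep.obj (Fin.last (m + 1)) ⟶ B)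
    (b : ∀ k : Fin (m + 1), D.Y k ⟶ W.obj k)
    (ha : IsStableIso a.hom.hom) (hb : ∀ k, IsStableIso (b k).hom.hom)
    (h₀ : D.g 0 ≫ b 0 = a ≫ z)
    (h : ∀ k : Fin m, (CategoryTheory.Quotient.functor (stableRel A)).map (D.psi k ≫ b k.succ) =
      (CategoryTheory.Quotient.functor (stableRel A)).map (b k.castSucc ≫ step W k)) :
    Nonempty (D.rot ≅ (stabilize A (m + 1)).obj (W.precomp (X := B) z)) := by
  let F := CategoryTheory.Quotient.functor (stableRel A)
  let V := (ComposableArrows.mkOfObjOfMapSucc D.Y D.psi).precomp (D.g 0)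
  let c : ∀ k : Fin (m + 2), V.obj k ⟶ (W.precomp (X := B) z).obj k := Fin.cases a b
  have hc : ∀ k, IsIso (F.map (c k)) := Fin.cases ha hb
  have hw : ∀ k : Fin (m + 1), F.map (step V k) ≫ F.map (c k.succ) =
      F.map (c k.castSucc) ≫ F.map (step (W.precomp (X := B) z) k) := by
    intro k
    rw [← Functor.map_comp, ← Functor.map_comp]
    cases k using Fin.cases with
    | zero => exact congrArg F.map h₀
    | succ k =>
      refine Eq.trans (congrArg F.map ?_) (h k)
      exact congrArg (· ≫ b k.succ) (step_mkOfObjOfMapSucc D.Y D.psi k)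
  exact ⟨ComposableArrows.isoMk (F := D.rot)
    (G := (stabilize A (m + 1)).obj (W.precomp (X := B) z))
    (fun k => @asIso _ _ _ _ (F.map (c k)) (hc k)) fun i hi => hw ⟨i, hi⟩⟩

variable {D E}

/-- Stable isomorphisms on the first two corners of the defining pushouts induce a stable
isomorphism of the pushouts. -/
theorem isStableIso_pushout [IsArtinianRing A] (hA : Module.Injective A A)
    {X B I Y X' B' I' Y' : FGModuleCat.{u} A} {l : X ⟶ B} {h : X ⟶ I} {g : B ⟶ Y} {j : I ⟶ Y}
    {l' : X' ⟶ B'} {h' : X' ⟶ I'} {g' : B' ⟶ Y'} {j' : I' ⟶ Y'} (sq : IsPushout l h g j)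
    (sq' : IsPushout l' h' g' j') (hh : IsInjectiveEnvelope h.hom.hom)
    (hh' : IsInjectiveEnvelope h'.hom.hom) {f : X ⟶ X'} {b : B ⟶ B'} {t : I ⟶ I'} {y : Y ⟶ Y'}
    (hf : IsStableIso f.hom.hom) (hb : IsStableIso b.hom.hom) (hl : l ≫ b = f ≫ l')
    (ht : h ≫ t = f ≫ h') (hg : g ≫ y = b ≫ g') (hj : j ≫ y = t ≫ j') :
    IsStableIso y.hom.hom := by
  have hl' : ∀ x, b.hom.hom (l.hom.hom x) = l'.hom.hom (f.hom.hom x) :=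
    LinearMap.congr_fun (congrArg (fun k => k.hom.hom) hl)
  have ht' : ∀ x, t.hom.hom (h.hom.hom x) = h'.hom.hom (f.hom.hom x) :=
    LinearMap.congr_fun (congrArg (fun k => k.hom.hom) ht)
  have hg' : ∀ x, y.hom.hom (g.hom.hom x) = g'.hom.hom (b.hom.hom x) :=
    LinearMap.congr_fun (congrArg (fun k => k.hom.hom) hg)
  have hj' : ∀ x, y.hom.hom (j.hom.hom x) = j'.hom.hom (t.hom.hom x) :=
    LinearMap.congr_fun (congrArg (fun k => k.hom.hom) hj)
  -- Both `I` and `I'` vanish stably, so nothing is asked of `t`.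
  have hbt : IsStableIso (b.hom.hom.prodMap t.hom.hom) := by
    refine IsStableIso.of_comp (g := LinearMap.fst A B' I') ?_
      (isStableIso_fst hA hh'.injective_module)
    exact (isStableIso_fst (M := B) hA hh.injective_module).comp hb
  refine isStableIso_of_exact hA (i := l.hom.hom.prod (-h.hom.hom))
    (i' := l'.hom.hom.prod (-h'.hom.hom)) (fun x x' hx => ?_)
    (coprod_surjective_of_isPushout sq) (exact_of_isPushout sq) (fun x x' hx => ?_)
    (coprod_surjective_of_isPushout sq') (exact_of_isPushout sq') (fun x => ?_) (fun x => ?_) hf hbt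
  · exact hh.injective (neg_injective (congrArg Prod.snd hx :))
  · exact hh'.injective (neg_injective (congrArg Prod.snd hx :))
  · simp [hl', ht']
  · simp [hg', hj']

/-- A componentwise stable isomorphism of the chosen representatives induces an isomorphism of
the rotations. -/
theorem nonempty_rot_iso_of_rep [IsArtinianRing A] (hA : Module.Injective A A)
    (f : D.rep ⟶ E.rep) [IsIso ((stabilize A (m + 1)).map f)] : Nonempty (D.rot ≅ E.rot) := by
  have hf := isStableIso_app f
  have key : ∀ k : Fin (m + 1), ∃ t : D.I k ⟶ E.I k, D.h k ≫ t = f.app k.castSucc ≫ E.h k := by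
    intro k
    obtain ⟨t, ht⟩ := (E.envelope k).injective_module.out (D.h k).hom.hom
      (D.envelope k).injective (f.app k.castSucc ≫ E.h k).hom.hom
    exact ⟨FGModuleCat.ofHom t, FGModuleCat.hom_ext (LinearMap.ext ht)⟩
  choose t ht using key
  have hl : ∀ k : Fin (m + 1), toLast D.rep k.castSucc ≫ f.app (Fin.last (m + 1)) =
      f.app k.castSucc ≫ toLast E.rep k.castSucc := fun k => f.naturality _
  have key : ∀ k : Fin (m + 1), ∃ y : D.Y k ⟶ E.Y k,
      D.g k ≫ y = f.app (Fin.last (m + 1)) ≫ E.g k ∧ D.j k ≫ y = t k ≫ E.j k := by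
    intro k
    have w : toLast D.rep k.castSucc ≫ f.app (Fin.last (m + 1)) ≫ E.g k =
        D.h k ≫ t k ≫ E.j k := by
      rw [← Category.assoc, hl, ← Category.assoc, ht, Category.assoc, Category.assoc,
        (E.isPushout k).w]
    exact ⟨(D.isPushout k).desc _ _ w, (D.isPushout k).inl_desc _ _ w,
      (D.isPushout k).inr_desc _ _ w⟩
  choose y hg hj using key
  refine D.nonempty_rot_iso_stabilize (ComposableArrows.mkOfObjOfMapSucc E.Y E.psi) _ (E.g 0)
    (f.app (Fin.last (m + 1))) y (hf _)
    (fun k => isStableIso_pushout hA (D.isPushout k) (E.isPushout k) (D.envelope k) (E.envelope k)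
      (hf _) (hf _) (hl k) (ht k) (hg k) (hj k)) (hg 0) fun k => ?_
  have hst : step D.rep k.castSucc ≫ f.app k.succ.castSucc =
      f.app k.castSucc.castSucc ≫ step E.rep k.castSucc := f.naturality _
  -- The extensions `t` need not commute with the maps `s`. Their discrepancy vanishes on the image
  -- of `h`, so with zero on `X_1` it descends to `d` on the pushout, and the defect of the square
  -- factors through the injective `E.I k.succ`.
  have hts : D.h k.castSucc ≫ (D.s k ≫ t k.succ - t k.castSucc ≫ E.s k) = 0 := by
    rw [Preadditive.comp_sub, sub_eq_zero, ← Category.assoc, D.comm, Category.assoc, ht,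
      ← Category.assoc, ← Category.assoc, ht, Category.assoc _ _ (E.s k), E.comm, ← Category.assoc]
    exact congrArg (· ≫ E.h k.succ) hst
  let d : D.Y k.castSucc ⟶ E.I k.succ := (D.isPushout k.castSucc).desc 0
    (D.s k ≫ t k.succ - t k.castSucc ≫ E.s k) (by rw [hts, Limits.comp_zero])
  have hgd : D.g k.castSucc ≫ d = 0 := (D.isPushout k.castSucc).inl_desc _ _ _
  have hjd : D.j k.castSucc ≫ d = D.s k ≫ t k.succ - t k.castSucc ≫ E.s k :=
    (D.isPushout k.castSucc).inr_desc _ _ _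
  have hd : D.psi k ≫ y k.succ - y k.castSucc ≫ E.psi k = d ≫ E.j k.succ := by
    refine (D.isPushout k.castSucc).hom_ext ?_ ?_
    · rw [← Category.assoc (D.g k.castSucc) d, hgd, Preadditive.comp_sub, g_psi_assoc, hg,
        ← Category.assoc (D.g k.castSucc), hg, Category.assoc, g_psi, sub_self, Limits.zero_comp]
    · rw [← Category.assoc (D.j k.castSucc) d, hjd, Preadditive.comp_sub, j_psi_assoc, hj,
        ← Category.assoc (D.j k.castSucc), hj, Category.assoc, j_psi, Preadditive.sub_comp,
        Category.assoc, Category.assoc]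
  refine Eq.trans (CategoryTheory.Quotient.sound _ ⟨E.I k.succ, d, E.j k.succ,
    projective_of_injective hA (E.envelope k.succ).injective_module, hd⟩) ?_
  exact congrArg (fun p => (CategoryTheory.Quotient.functor (stableRel A)).map (y k.castSucc ≫ p))
    (step_mkOfObjOfMapSucc E.Y E.psi k).symm

/-- The rotation of a chain depends, up to isomorphism, only on its stable isomorphism class. -/
theorem nonempty_rot_iso [IsArtinianRing A] (hA : Module.Injective A A) (e : S ≅ T) :
    Nonempty (D.rot ≅ E.rot) := by
  -- The stable isomorphism `D.rep ≅ E.rep` may fail to lift, but its composite with `Mimo D.rep ⟶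
  -- D.rep` starts at monomorphisms and does. Both rotations are compared with that of `Mimo D.rep`.
  obtain ⟨M⟩ := nonempty_mimoData hA D.rep
  obtain ⟨V, hV⟩ := exists_rotationData hA M.mimo
  have hproj : IsIso ((stabilize A (m + 1)).map M.proj) :=
    isIso_stabilize_map _ (M.isStableIso_proj hA)
  obtain ⟨f, hf⟩ := exists_stabilize_map_eq hA M.injective_step_mimo
    ((stabilize A (m + 1)).map M.proj ≫ (eqToIso D.rep_eq ≪≫ e ≪≫ eqToIso E.rep_eq.symm).hom)
  have hf' : IsIso ((stabilize A (m + 1)).map f) := hf ▸ inferInstance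
  have hπ : ∀ {X Z : ComposableArrows (FGModuleCat.{u} A) (m + 1)} (h : V.rep = X) (p : X ⟶ Z),
      IsIso ((stabilize A (m + 1)).map p) →
        IsIso ((stabilize A (m + 1)).map (eqToHom h ≫ p)) := by
    intro X Z h p hp
    rw [Functor.map_comp]
    infer_instance
  have := hπ hV M.proj hproj
  have := hπ hV f hf'
  obtain ⟨i⟩ := nonempty_rot_iso_of_rep (D := V) (E := D) hA (eqToHom hV ≫ M.proj)
  obtain ⟨j⟩ := nonempty_rot_iso_of_rep (D := V) (E := E) hA (eqToHom hV ≫ f)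
  exact ⟨i.symm ≪≫ j⟩

theorem injective_toLast {X : ComposableArrows (FGModuleCat.{u} A) m}
    (hX : ∀ k, Function.Injective (step X k).hom.hom) (k : Fin (m + 1)) :
    Function.Injective (toLast X k).hom.hom := by
  induction k using Fin.reverseInduction with
  | last =>
    have : toLast X (Fin.last m) = 𝟙 _ := X.map_id _
    rw [this]
    exact Function.injective_id
  | cast k ih =>
    have : toLast X k.castSucc = step X k ≫ toLast X k.succ :=
      X.map_comp (homOfLE (Fin.castSucc_lt_succ (i := k)).le) (homOfLE (Fin.le_last k.succ))
    rw [this]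
    exact ih.comp (hX k)

/-- The rotation of a chain of monomorphisms is given by its cokernels. -/
theorem nonempty_rot_iso_cok [IsArtinianRing A] (hA : Module.Injective A A)
    (hX : ∀ k, Function.Injective (step D.rep k).hom.hom) :
    Nonempty (D.rot ≅ (stabilize A (m + 1)).obj (cok D.rep)) := by
  have key : ∀ k : Fin (m + 1), ∃ y : D.Y k ⟶ (cokChain D.rep).obj k,
      D.g k ≫ y = FGModuleCat.ofHom (Submodule.mkQ _) ∧ D.j k ≫ y = 0 := by
    intro k
    have w : toLast D.rep k.castSucc ≫ (FGModuleCat.ofHom (Submodule.mkQ _) :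
        D.rep.obj (Fin.last (m + 1)) ⟶ (cokChain D.rep).obj k) = D.h k ≫ 0 := by
      rw [Limits.comp_zero]
      exact FGModuleCat.hom_ext (LinearMap.ext fun x =>
        (Submodule.Quotient.mk_eq_zero _).mpr ⟨x, rfl⟩)
    exact ⟨(D.isPushout k).desc _ _ w, (D.isPushout k).inl_desc _ _ w,
      (D.isPushout k).inr_desc _ _ w⟩
  choose y hg hj using key
  have hg' : ∀ k x, (y k).hom.hom ((D.g k).hom.hom x) = Submodule.mkQ _ x := fun k =>
    LinearMap.congr_fun (congrArg (fun k => k.hom.hom) (hg k))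
  have hj' : ∀ k x, (y k).hom.hom ((D.j k).hom.hom x) = 0 := fun k =>
    LinearMap.congr_fun (congrArg (fun k => k.hom.hom) (hj k))
  refine D.nonempty_rot_iso_stabilize (cokChain D.rep) _ _ (𝟙 _) y ?_ (fun k => ?_) ?_ fun k => ?_
  · exact (isIso_functor_map_iff (𝟙 _)).mp inferInstance
  · have hw : ∀ x, (D.g k).hom.hom ((toLast D.rep k.castSucc).hom.hom x) =
        (D.j k).hom.hom ((D.h k).hom.hom x) :=
      LinearMap.congr_fun (congrArg (fun k => k.hom.hom) (D.isPushout k).w)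
    -- The kernel of `Y → Coker` is `I`, embedded by `j`: a pushout of the monomorphism `toLast` is
    -- a monomorphism.
    refine isStableIso_of_injective_kernel hA (k := (D.j k).hom.hom)
      ((injective_iff_map_eq_zero _).mpr fun x hx => ?_) (fun z => ?_) (fun z => ⟨fun hz => ?_, ?_⟩)
      (D.envelope k).injective_module
    · obtain ⟨v, hv⟩ := (exact_of_isPushout (D.isPushout k) (0, x)).mp (by simpa using hx)
      have hv0 : v = 0 := injective_toLast hX k.castSucc
        ((congrArg Prod.fst hv).trans (map_zero _).symm)
      have hv' : -(D.h k).hom.hom v = x := congrArg Prod.snd hv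
      rw [← hv', hv0, map_zero, neg_zero]
    · obtain ⟨x, rfl⟩ := Submodule.mkQ_surjective _ z
      exact ⟨_, hg' k x⟩
    · obtain ⟨⟨b, x⟩, rfl⟩ := coprod_surjective_of_isPushout (D.isPushout k) z
      rw [LinearMap.coprod_apply, map_add] at hz
      have hz' := (congrArg₂ (· + ·) (hg' k b) (hj' k x)).symm.trans hz
      obtain ⟨v, rfl⟩ := (Submodule.Quotient.mk_eq_zero _).mp ((add_zero _).symm.trans hz')
      exact ⟨(D.h k).hom.hom v + x, by rw [map_add, LinearMap.coprod_apply, hw]⟩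
    · rintro ⟨x, rfl⟩
      exact hj' k x
  · exact (hg 0).trans (Category.id_comp _).symm
  · refine congrArg _ ((D.isPushout k.castSucc).hom_ext ?_ ?_)
    · rw [g_psi_assoc, hg, ← Category.assoc, hg]
      rfl
    · rw [j_psi_assoc, hj, Limits.comp_zero, ← Category.assoc, hj, Limits.zero_comp]

end RotationData

end Rotation

end MorphismCategory
end
open MorphismCategory in
theorem lemma3p1 {R : Type w} [CommRing R] [IsArtinianRing R]
    {A : Type u} [Ring A] [Algebra R A] [Module.Finite R A]
    (hA : Module.Injective A A) (m : ℕ) :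
    -- the constructions of `Mimo` and of the rotation can always be carried out
    (∀ X : ComposableArrows (FGModuleCat.{u} A) (m + 1),
      Nonempty (MorphismCategory.MimoData X)) ∧
    (∀ S : ComposableArrows (MorphismCategory.StMod A) (m + 1),
      Nonempty (MorphismCategory.RotationData S)) ∧
    -- the rotation of the stable image of `X` is the stable image of `Cok Mimo X`
    (∀ (X : ComposableArrows (FGModuleCat.{u} A) (m + 1))
      (D : MorphismCategory.RotationData ((MorphismCategory.stabilize A (m + 1)).obj X))
      (M : MorphismCategory.MimoData X),
      Nonempty (D.rot ≅
        (MorphismCategory.stabilize A (m + 1)).obj (MorphismCategory.cok M.mimo))) ∧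
    -- up to isomorphism the rotation depends neither on the choices nor on the isomorphism class
    (∀ (S T : ComposableArrows (MorphismCategory.StMod A) (m + 1)), Nonempty (S ≅ T) →
      ∀ (D : MorphismCategory.RotationData S) (E : MorphismCategory.RotationData T),
      Nonempty (D.rot ≅ E.rot)) := by
  have : IsArtinianRing A := IsArtinianRing.of_finite R A
  refine ⟨nonempty_mimoData hA, fun S => ?_, fun X D M => ?_, fun S T ⟨e⟩ D E =>
    RotationData.nonempty_rot_iso hA e⟩
  · obtain ⟨X, rfl⟩ := exists_stabilize_obj_eq S
    exact ⟨(exists_rotationData hA X).choose⟩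
  · have := isIso_stabilize_map _ (M.isStableIso_proj hA)
    obtain ⟨V, hV⟩ := exists_rotationData hA M.mimo
    -- Invariance replaces `X` by the stably isomorphic `Mimo X`, whose rotation is given by
    -- cokernels.
    obtain ⟨i⟩ := RotationData.nonempty_rot_iso (D := D) (E := V) hA
      (asIso ((stabilize A (m + 1)).map M.proj)).symm
    obtain ⟨j⟩ := RotationData.nonempty_rot_iso_cok (D := V) hA fun k => by
      rw [hV]
      exact M.injective_step_mimo k
    exact ⟨i ≪≫ j ≪≫ eqToIso (by rw [hV])⟩
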